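/- Let $\mathbb H=\langle a,b\mid aba^{-1}b^{-1}\text{ is central}\rangle$ be the discrete Heisenberg group, and let $d_W$ be the left-invariant word metric on $\mathbb H$ associated to the symmetric generating set $\{a,b,a^{-1},b^{-1}\}$. For a real Banach space $(X,\|\cdot\|)$ and a function $f:\mathbb H\to X$, let the compression function $\omega_f$ be the largest function of the distance such that $\|f(x)-f(y)\|\ge \omega_f(d_W(x,y))$ for all $x,y\in\mathbb H$; that is, for each integer $n\ge 1$, $$\omega_f(n)=\inf\{\|f(x)-f(y)\| : x,y\in\mathbb H,\ d_W(x,y)=n\}.$$ There is a universal constant $C>0$ with the following property. Let $p\in[2,\infty)$ and let $(X,\|\cdot\|)$ be a real Banach space for which there exists $K>0$ such that $$\left\|\frac{x+y}{2}\right\|^p\le \frac{\|x\|^p+\|y\|^p}{2}-\frac{1}{K^p}\left\|\frac{x-y}{2}\right\|^p\qquad\text{for all }x,y\in X,$$ and let $K_p(X)$ denote the infimum of all such $K>0$. Let $f:\mathbb H\to X$ be $1$-Lipschitz with respect to $d_W$. Then for every real $t\ge 3$ there is an integer $n$ with $t\le n\le t^2$ and $$\frac{\omega_f(n)}{n}\le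 C\,K_p(X)\left(\frac{\log\log n}{\log n}\right)^{1/p}.$$ -/

import Mathlib

/-- The relators of the discrete Heisenberg group: the commutator `a b a⁻¹ b⁻¹` of the two free
generators `a`, `b` (indexed by `0`, `1`) commutes with every word `g`, i.e. it is central. -/
def heisenbergRels : Set (FreeGroup (Fin 2)) :=
  let a : FreeGroup (Fin 2) := FreeGroup.of 0
  let b : FreeGroup (Fin 2) := FreeGroup.of 1
  let c : FreeGroup (Fin 2) := a * b * a⁻¹ * b⁻¹
  {r | ∃ g : FreeGroup (Fin 2), r = c * g * c⁻¹ * g⁻¹}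

/-- The discrete Heisenberg group `⟨a, b | a b a⁻¹ b⁻¹ is central⟩`. -/
abbrev Heisenberg : Type := PresentedGroup heisenbergRels

namespace Heisenberg

/-- The first canonical generator. -/
def a : Heisenberg := PresentedGroup.of 0

/-- The second canonical generator. -/
def b : Heisenberg := PresentedGroup.of 1

/-- The symmetric generating set `S = {a, b, a⁻¹, b⁻¹}`. -/
def S : Set Heisenberg := {a, b, a⁻¹, b⁻¹}

/-- The word length with respect to `S`: the least length of a product of elements of `S`
representing `g`. -/
noncomputable def wordLength (g : Heisenberg) : ℕ :=
  sInf {n : ℕ | ∃ l : List Heisenberg, (∀ s ∈ l, s ∈ S) ∧ l.prod = g ∧ l.length = n}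

/-- The left-invariant word metric `d_W` associated to `S`. -/
noncomputable def wordDist (x y : Heisenberg) : ℕ := wordLength (x⁻¹ * y)

/-- The compression function `ω_f` of `f`: its value at `t` is the infimum of `‖f x - f y‖` over all
pairs with `d_W(x, y) = t`, so that it is the largest function with
`ω_f (d_W(x, y)) ≤ ‖f x - f y‖` for all `x`, `y`. -/
noncomputable def compression {X : Type*} [NormedAddCommGroup X] (f : Heisenberg → X) (t : ℝ) : ℝ :=
  sInf {r : ℝ | ∃ x y : Heisenberg, (wordDist x y : ℝ) = t ∧ ‖f x - f y‖ = r}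

/-- Every element is a product of elements of `S`, so `wordLength` is attained. -/
theorem exists_word (g : Heisenberg) :
    ∃ l : List Heisenberg, (∀ s ∈ l, s ∈ S) ∧ l.prod = g ∧ l.length = wordLength g := by
  have hne : {n : ℕ | ∃ l : List Heisenberg,
      (∀ s ∈ l, s ∈ S) ∧ l.prod = g ∧ l.length = n}.Nonempty := by
    have hg : g ∈ Subgroup.closure
        (Set.range (PresentedGroup.of : Fin 2 → PresentedGroup heisenbergRels)) := by
      rw [PresentedGroup.closure_range_of]; trivial
    rw [← Subgroup.mem_toSubmonoid, Subgroup.closure_toSubmonoid] at hg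
    obtain ⟨l, hl, hp⟩ := Submonoid.exists_list_of_mem_closure hg
    refine ⟨l.length, l, fun s hs => ?_, hp, rfl⟩
    rcases hl s hs with ⟨i, hi⟩ | ⟨i, hi⟩
    · fin_cases i
      · left; exact hi.symm
      · right; left; exact hi.symm
    · have hi' : s = (PresentedGroup.of i)⁻¹ := by rw [hi, inv_inv]
      fin_cases i
      · right; right; left; exact hi'
      · right; right; right; exact hi'
  exact Nat.sInf_mem hne

/-- Every natural number is a distance, so the infimum defining `compression f n` is over a
nonempty set. -/
theorem exists_wordDist_eq (n : ℕ) : ∃ x y : Heisenberg, wordDist x y = n := by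
  let φ : Heisenberg →* Multiplicative ℤ :=
    PresentedGroup.toGroup (f := fun i => if i = 0 then Multiplicative.ofAdd (1 : ℤ) else 1) (by
      rintro r ⟨g, rfl⟩
      simp)
  have ha : φ a = Multiplicative.ofAdd (1 : ℤ) := by
    simp [φ, a, PresentedGroup.toGroup.of]
  have hb : φ b = 1 := by
    simp [φ, b, PresentedGroup.toGroup.of]
  have key : ∀ l : List Heisenberg, (∀ s ∈ l, s ∈ S) →
      Multiplicative.toAdd (φ l.prod) ≤ (l.length : ℤ) := by
    intro l
    induction l with
    | nil => simp
    | cons s l ih =>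
      intro h
      have h1 := ih fun s hs => h s (List.mem_cons_of_mem _ hs)
      have h2 : Multiplicative.toAdd (φ s) ≤ 1 := by
        rcases h s List.mem_cons_self with rfl | rfl | rfl | rfl <;> simp [ha, hb]
      simp only [List.prod_cons, map_mul, toAdd_mul, List.length_cons]
      push_cast
      linarith
  refine ⟨1, a ^ n, ?_⟩
  have hle : wordLength (a ^ n) ≤ n :=
    Nat.sInf_le ⟨List.replicate n a, fun s hs => Or.inl (List.eq_of_mem_replicate hs), by simp,
      by simp⟩
  obtain ⟨l, hl, hp, hlen⟩ := exists_word (a ^ n)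
  have := key l hl
  rw [hp, map_pow, ha, hlen] at this
  simp only [wordDist, inv_one, one_mul]
  simp at this
  omega

/-- The defining property of the compression function: it is the largest function of the distance
that bounds `‖f x - f y‖` from below. -/
theorem le_compression_iff {X : Type*} [NormedAddCommGroup X] (f : Heisenberg → X) (n : ℕ) (r : ℝ) :
    r ≤ compression f n ↔ ∀ x y : Heisenberg, wordDist x y = n → r ≤ ‖f x - f y‖ := by
  have hne : {r : ℝ | ∃ x y : Heisenberg, (wordDist x y : ℝ) = n ∧ ‖f x - f y‖ = r}.Nonempty := by
    obtain ⟨x, y, h⟩ := exists_wordDist_eq n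
    exact ⟨_, x, y, by rw [h], rfl⟩
  have hbdd : BddBelow {r : ℝ | ∃ x y : Heisenberg, (wordDist x y : ℝ) = n ∧ ‖f x - f y‖ = r} :=
    ⟨0, by rintro _ ⟨x, y, -, rfl⟩; exact norm_nonneg _⟩
  rw [compression, le_csInf_iff hbdd hne]
  constructor
  · intro h x y hxy
    exact h _ ⟨x, y, by rw [hxy], rfl⟩
  · rintro h _ ⟨x, y, hxy, rfl⟩
    exact h x y (by exact_mod_cast hxy)

end Heisenberg

/-- The `p`-convexity inequality with constant `K` for the norm of `X`. -/
def PConvexIneq (X : Type*) [NormedAddCommGroup X] [NormedSpace ℝ X] (p K : ℝ) : Prop :=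
  ∀ x y : X, ‖(2⁻¹ : ℝ) • (x + y)‖ ^ p ≤
    (‖x‖ ^ p + ‖y‖ ^ p) / 2 - 1 / K ^ p * ‖(2⁻¹ : ℝ) • (x - y)‖ ^ p

/-- `K_p(X)`: the infimum over those `K > 0` for which the `p`-convexity inequality holds. -/
noncomputable def pConvexityConst (X : Type*) [NormedAddCommGroup X] [NormedSpace ℝ X] (p : ℝ) : ℝ :=
  sInf {K : ℝ | 0 < K ∧ PConvexIneq X p K}

/-! The Heisenberg group is amenable, so the increments `x ↦ f (x * g) - f x` form a cocycle for
right translations, which are isometric for the `L^p` seminorm of a right-invariant mean. That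
seminorm is `p`-convex with the same `K`. The cocycle has size at most one on the generators, and at
`g` it is at least the compression of `f` at the word length of `g`. It is therefore enough to find
`n` for which the cocycle at `c ^ n ^ 2`, an element of word length between `n` and `4 * n`, is
small compared with `n`.

This is `IsCocycle.exists_central_pow_le`. Since `c ^ (x * y)` is a commutator of powers, a cocycle
grows like a square root along the centre. Hence averaging its value at `c ^ n ^ 2` over `(n / q) ^
2` central translates changes it by at most `16 * n / q`, whereas averaging over `(q * n) ^ 2` of
them leaves at most `4 * n / q`. What remains is a difference `U` of a translated short average and
the long average. As `c` is central, `U` commutes with the representation, so the commutator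
estimate bounds the remainder by `2 * n` times the sizes of `U (f a)` and `U (f b)`.

Convexity makes these small at some scale: by `Seminorm.PConvex.sum_ergodicAverage_sub_le` they are
controlled, on average over blocks, by the drop of the `p`-th power of the averaged norm from one
scale to the next. The drops over `J` scales telescope to at most 2, so one of them is at most `2 /
J`.

The resulting bound is `20 / q + 16 * K * (1 / J) ^ (1 / p)`. With `q` about `√(log t)`, the
interval `[t, t ^ 2]` has room for `J` of order `log t / log log t` scales (`exists_scales`), and
both terms have the required order. -/

open Finset

/-! ### Averages in `p`-convex seminormed spaces -/

/-- The `p`-convexity inequality with constant `K` for a seminorm. -/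
def Seminorm.PConvex {V : Type*} [AddCommGroup V] [Module ℝ V] (N : Seminorm ℝ V) (p K : ℝ) :
    Prop :=
  ∀ x y : V, N ((2⁻¹ : ℝ) • (x + y)) ^ p ≤
    (N x ^ p + N y ^ p) / 2 - 1 / K ^ p * N ((2⁻¹ : ℝ) • (x - y)) ^ p

section Averages

variable {V ι : Type*} [AddCommGroup V] [Module ℝ V] (N : Seminorm ℝ V) {p K : ℝ}

theorem Seminorm.map_sum_le (s : Finset ι) (Y : ι → V) : N (∑ i ∈ s, Y i) ≤ ∑ i ∈ s, N (Y i) :=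
  le_sum_of_subadditive N (map_zero N).le (map_add_le_add N) s Y

/-- Jensen's inequality for the `p`-th power of a seminorm of an average. -/
theorem Seminorm.rpow_average_le (hp : 1 ≤ p) (s : Finset ι) (hs : s.Nonempty) (Y : ι → V) :
    N ((#s : ℝ)⁻¹ • ∑ i ∈ s, Y i) ^ p ≤ (#s : ℝ)⁻¹ * ∑ i ∈ s, N (Y i) ^ p := by
  have hc : (0 : ℝ) < #s := by exact_mod_cast hs.card_pos
  have h1 : N ((#s : ℝ)⁻¹ • ∑ i ∈ s, Y i) ≤ ∑ i ∈ s, (#s : ℝ)⁻¹ * N (Y i) := by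
    rw [map_smul_eq_mul, ← mul_sum, Real.norm_of_nonneg (by positivity)]
    gcongr
    exact N.map_sum_le s Y
  calc _ ≤ (∑ i ∈ s, (#s : ℝ)⁻¹ * N (Y i)) ^ p :=
        Real.rpow_le_rpow (apply_nonneg N _) h1 (by linarith)
    _ ≤ ∑ i ∈ s, (#s : ℝ)⁻¹ * N (Y i) ^ p :=
        Real.rpow_arith_mean_le_arith_mean_rpow s _ _ (fun _ _ => by positivity)
          (by simp [hc.ne']) (fun _ _ => apply_nonneg N _) hp
    _ = _ := by rw [mul_sum]

/-- In a `p`-convex space the deviation from the average is controlled by the drop in the mean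
`p`-th power of the norm. -/
theorem Seminorm.PConvex.sum_deviation_le (hN : N.PConvex p K) (hp : 1 ≤ p) (hK : 0 < K)
    (s : Finset ι) (hs : s.Nonempty) (Y : ι → V) :
    ∑ i ∈ s, N (Y i - (#s : ℝ)⁻¹ • ∑ j ∈ s, Y j) ^ p ≤
      (2 * K) ^ p * (∑ i ∈ s, N (Y i) ^ p - #s * N ((#s : ℝ)⁻¹ • ∑ i ∈ s, Y i) ^ p) := by
  have hc : (0 : ℝ) < #s := by exact_mod_cast hs.card_pos
  have hKp : 0 < K ^ p := by positivity
  set y := (#s : ℝ)⁻¹ • ∑ j ∈ s, Y j with hy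
  -- Jensen, as `Y i - y` is the average over `j` of `Y i - Y j`.
  have hdev : ∀ i, N (Y i - y) ^ p ≤
      (#s : ℝ)⁻¹ * ∑ j ∈ s, 2 ^ p * N ((2⁻¹ : ℝ) • (Y i - Y j)) ^ p := by
    intro i
    have : Y i - y = (#s : ℝ)⁻¹ • ∑ j ∈ s, (Y i - Y j) := by
      rw [sum_sub_distrib, sum_const, smul_sub, ← Nat.cast_smul_eq_nsmul ℝ, smul_smul,
        inv_mul_cancel₀ hc.ne', one_smul]
    rw [this]
    refine (N.rpow_average_le hp s hs _).trans_eq ?_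
    congr 1
    refine sum_congr rfl fun j _ => ?_
    rw [← Real.mul_rpow (by norm_num) (apply_nonneg N _), map_smul_eq_mul]
    congr 1
    rw [Real.norm_of_nonneg (by norm_num), mul_inv_cancel_left₀ (by norm_num)]
  -- Jensen over pairs: the midpoints of all pairs again average to `y`. Convexity applied to each
  -- pair then turns this into a bound on the sum of the differences.
  have hmid : (#s : ℝ) ^ 2 * N y ^ p ≤
      ∑ i ∈ s, ∑ j ∈ s, N ((2⁻¹ : ℝ) • (Y i + Y j)) ^ p := by
    have h := N.rpow_average_le hp (s ×ˢ s) (hs.product hs)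
      (fun ij => (2⁻¹ : ℝ) • (Y ij.1 + Y ij.2))
    have e : ((#(s ×ˢ s) : ℕ) : ℝ)⁻¹ • ∑ ij ∈ s ×ˢ s, (2⁻¹ : ℝ) • (Y ij.1 + Y ij.2) = y := by
      rw [sum_product, card_product]
      simp only [← smul_sum, sum_add_distrib, sum_const, smul_smul]
      rw [← two_smul ℝ, hy, ← Nat.cast_smul_eq_nsmul ℝ]
      simp only [smul_smul]
      congr 1
      push_cast
      field_simp
    rw [e, card_product, sum_product] at h
    push_cast at h
    rwa [← div_eq_inv_mul, le_div_iff₀ (by positivity), mul_comm, ← sq] at h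
  have hsum : ∑ i ∈ s, ∑ j ∈ s, N ((2⁻¹ : ℝ) • (Y i + Y j)) ^ p ≤
      #s * ∑ i ∈ s, N (Y i) ^ p -
        1 / K ^ p * ∑ i ∈ s, ∑ j ∈ s, N ((2⁻¹ : ℝ) • (Y i - Y j)) ^ p := by
    refine (sum_le_sum fun i _ => sum_le_sum fun j _ => hN (Y i) (Y j)).trans_eq ?_
    simp only [sum_sub_distrib, ← mul_sum, ← sum_div, sum_add_distrib, sum_const, nsmul_eq_mul]
    ring
  have htot : ∑ i ∈ s, N (Y i - y) ^ p ≤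
      (#s : ℝ)⁻¹ * (2 ^ p * ∑ i ∈ s, ∑ j ∈ s, N ((2⁻¹ : ℝ) • (Y i - Y j)) ^ p) := by
    refine (sum_le_sum fun i _ => hdev i).trans_eq ?_
    simp only [← mul_sum]
  refine htot.trans ?_
  set D := ∑ i ∈ s, ∑ j ∈ s, N ((2⁻¹ : ℝ) • (Y i - Y j)) ^ p
  have hD : D ≤ K ^ p * (#s * ∑ i ∈ s, N (Y i) ^ p - (#s : ℝ) ^ 2 * N y ^ p) := by
    have h := hmid.trans hsum
    have h' : 1 / K ^ p * D ≤ #s * ∑ i ∈ s, N (Y i) ^ p - (#s : ℝ) ^ 2 * N y ^ p := by linarith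
    rwa [one_div, ← div_eq_inv_mul, div_le_iff₀ hKp, mul_comm] at h'
  calc (#s : ℝ)⁻¹ * (2 ^ p * D) ≤ (#s : ℝ)⁻¹ *
        (2 ^ p * (K ^ p * (#s * ∑ i ∈ s, N (Y i) ^ p - (#s : ℝ) ^ 2 * N y ^ p))) := by gcongr
    _ = _ := by
      rw [Real.mul_rpow (by norm_num) hK.le]
      field_simp

end Averages

/-! ### Ergodic averages of an isometry -/

section Ergodic

variable {V : Type*} [AddCommGroup V] [Module ℝ V]

/-- The ergodic average `k⁻¹ (1 + T + ⋯ + T ^ (k - 1))`. -/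
noncomputable def ergodicAverage (T : Module.End ℝ V) (k : ℕ) : Module.End ℝ V :=
  (k : ℝ)⁻¹ • ∑ i ∈ range k, T ^ i

theorem sum_range_pow_mul (T : Module.End ℝ V) (r k : ℕ) :
    ∑ i ∈ range (r * k), T ^ i = ∑ i ∈ range r, T ^ (i * k) * ∑ j ∈ range k, T ^ j := by
  induction r with
  | zero => simp
  | succ r ih =>
    rw [sum_range_succ, Nat.succ_mul, sum_range_add, ih, mul_sum]
    simp only [pow_add]

/-- Cutting the long orbit into `r` consecutive blocks of length `k` is what lets convexity compare
two scales. -/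
theorem ergodicAverage_mul (T : Module.End ℝ V) (r k : ℕ) :
    ergodicAverage T (r * k) = (r : ℝ)⁻¹ • ∑ i ∈ range r, T ^ (i * k) * ergodicAverage T k := by
  rw [ergodicAverage, sum_range_pow_mul, ergodicAverage]
  simp only [mul_smul_comm, ← smul_sum, smul_smul]
  push_cast
  rw [mul_inv]

theorem Commute.ergodicAverage_right {U T : Module.End ℝ V} (h : Commute U T) (k : ℕ) :
    Commute U (ergodicAverage T k) :=
  (Commute.sum_right _ _ _ fun i _ => h.pow_right i).smul_right _

theorem Seminorm.map_pow_of_isometry (N : Seminorm ℝ V) {T : Module.End ℝ V}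
    (hT : ∀ v, N (T v) = N v) (i : ℕ) (v : V) : N ((T ^ i) v) = N v := by
  induction i with
  | zero => simp
  | succ i ih => rw [pow_succ', Module.End.mul_apply, hT, ih]

theorem Seminorm.ergodicAverage_le (N : Seminorm ℝ V) {T : Module.End ℝ V}
    (hT : ∀ v, N (T v) = N v) (k : ℕ) (v : V) : N (ergodicAverage T k v) ≤ N v := by
  rw [ergodicAverage, LinearMap.smul_apply, map_smul_eq_mul, LinearMap.sum_apply,
    Real.norm_of_nonneg (by positivity)]
  have : N (∑ i ∈ range k, (T ^ i) v) ≤ k * N v :=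
    (N.map_sum_le _ _).trans_eq (by simp [N.map_pow_of_isometry hT])
  rcases k.eq_zero_or_pos with rfl | hk
  · simp
  · rw [inv_mul_le_iff₀ (by exact_mod_cast hk)]
    exact this

theorem Seminorm.ergodicAverage_sub_le (N : Seminorm ℝ V) {T : Module.End ℝ V} {k : ℕ}
    (hk : 0 < k) {v : V} {ε : ℝ} (h : ∀ i < k, N (v - (T ^ i) v) ≤ ε) :
    N (v - ergodicAverage T k v) ≤ ε := by
  have hk' : (0 : ℝ) < k := by exact_mod_cast hk
  have e : v - ergodicAverage T k v = (k : ℝ)⁻¹ • ∑ i ∈ range k, (v - (T ^ i) v) := by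
    rw [sum_sub_distrib, sum_const, card_range, smul_sub, ← Nat.cast_smul_eq_nsmul ℝ, smul_smul,
      inv_mul_cancel₀ hk'.ne', one_smul, ergodicAverage, LinearMap.smul_apply, LinearMap.sum_apply]
  rw [e, map_smul_eq_mul, Real.norm_of_nonneg (by positivity), inv_mul_le_iff₀ hk']
  refine (N.map_sum_le _ _).trans ((sum_le_card_nsmul _ _ ε fun i hi => ?_).trans_eq ?_)
  · exact h i (mem_range.1 hi)
  · simp

/-- In a `p`-convex space, consecutive blocks of an ergodic average are on average close to the
long ergodic average if the norms of the short and of the long average are close. -/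
theorem Seminorm.PConvex.sum_ergodicAverage_sub_le {N : Seminorm ℝ V} {p K : ℝ}
    (hN : N.PConvex p K) (hp : 1 ≤ p) (hK : 0 < K) {T : Module.End ℝ V}
    (hT : ∀ v, N (T v) = N v) {r : ℕ} (hr : 0 < r) (k : ℕ) (v : V) :
    ∑ i ∈ range r, N ((T ^ (i * k) * ergodicAverage T k - ergodicAverage T (r * k)) v) ^ p ≤
      r * ((2 * K) ^ p *
        (N (ergodicAverage T k v) ^ p - N (ergodicAverage T (r * k) v) ^ p)) := by
  have h := hN.sum_deviation_le N hp hK (range r) (nonempty_range_iff.2 hr.ne')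
    (fun i => (T ^ (i * k)) (ergodicAverage T k v))
  have e : ((#(range r) : ℕ) : ℝ)⁻¹ • ∑ i ∈ range r, (T ^ (i * k)) (ergodicAverage T k v) =
      ergodicAverage T (r * k) v := by
    rw [ergodicAverage_mul, card_range, LinearMap.smul_apply, LinearMap.sum_apply]
    rfl
  rw [e] at h
  simp only [N.map_pow_of_isometry hT, sum_const, card_range, nsmul_eq_mul] at h
  refine h.trans_eq ?_
  ring

end Ergodic

/-! ### Commutators of powers -/

section HeisenbergRelation

variable {G : Type*} [Group G] {a b c : G}

theorem mul_pow_of_central (hab : a * b = c * (b * a)) (hc : ∀ g, Commute c g) (y : ℕ) :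
    a * b ^ y = c ^ y * (b ^ y * a) := by
  induction y with
  | zero => simp
  | succ y ih =>
    rw [pow_succ b, ← mul_assoc, ih, mul_assoc, mul_assoc (b ^ y), hab, ← mul_assoc (b ^ y) c,
      ← (hc (b ^ y)).eq, pow_succ c]
    simp only [mul_assoc]

/-- Each of the `x` letters `a` passes each of the `y` letters `b` at the cost of one `c`. This is
the quadratic distortion of the centre. -/
theorem pow_mul_pow_of_central (hab : a * b = c * (b * a)) (hc : ∀ g, Commute c g) (x y : ℕ) :
    a ^ x * b ^ y = c ^ (x * y) * (b ^ y * a ^ x) := by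
  induction x with
  | zero => simp
  | succ x ih =>
    rw [pow_succ' a, mul_assoc, ih, ← mul_assoc a, ← ((hc a).pow_left _).eq, mul_assoc,
      ← mul_assoc a, mul_pow_of_central hab hc, Nat.succ_mul, pow_add]
    simp only [mul_assoc]

end HeisenbergRelation

/-! ### Growth of cocycles along the centre -/

/-- A one-cocycle for the representation `ρ`. -/
def IsCocycle {G V : Type*} [Group G] [AddCommGroup V] [Module ℝ V] (ρ : G →* Module.End ℝ V)
    (f : G → V) : Prop :=
  ∀ g h, f (g * h) = f g + ρ g (f h)

namespace IsCocycle

variable {G V : Type*} [Group G] [AddCommGroup V] [Module ℝ V] {ρ : G →* Module.End ℝ V}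
  {f : G → V} {a b c : G} {N : Seminorm ℝ V} {p K : ℝ}

theorem map_one (hf : IsCocycle ρ f) : f 1 = 0 := by
  have h := hf 1 1
  simpa using h

theorem map_pow (hf : IsCocycle ρ f) (g : G) (m : ℕ) :
    f (g ^ m) = (m : ℝ) • ergodicAverage (ρ g) m (f g) := by
  have h : f (g ^ m) = ∑ i ∈ range m, (ρ g ^ i) (f g) := by
    induction m with
    | zero => simp [hf.map_one]
    | succ m ih => rw [pow_succ, hf, ih, sum_range_succ, _root_.map_pow]
  rcases m.eq_zero_or_pos with rfl | hm
  · simp [hf.map_one]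
  · have : (m : ℝ) ≠ 0 := by positivity
    rw [h, ergodicAverage, LinearMap.smul_apply, smul_smul, mul_inv_cancel₀ this, one_smul,
      LinearMap.sum_apply]

/-- An operator `U` commuting with the representation carries cocycles to cocycles, so growth
estimates survive with `U` inserted. The main argument needs this for differences of central
averages. -/
theorem map_pow_le (hf : IsCocycle ρ f) (hρ : ∀ g v, N (ρ g v) = N v) {U : Module.End ℝ V}
    (hU : ∀ g, Commute U (ρ g)) (g : G) (m : ℕ) : N (U (f (g ^ m))) ≤ m * N (U (f g)) := by
  rw [hf.map_pow, map_smul, map_smul_eq_mul, Real.norm_of_nonneg (by positivity),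
    ← Module.End.mul_apply, ((hU g).ergodicAverage_right m).eq, Module.End.mul_apply]
  gcongr
  exact N.ergodicAverage_le (hρ g) m _

/-- Bound for a cocycle on a central commutator. -/
theorem map_commutator_le (hf : IsCocycle ρ f) (hρ : ∀ g v, N (ρ g v) = N v)
    {U : Module.End ℝ V} (hU : ∀ g, Commute U (ρ g)) {g h w : G} (hw : g * h = w * (h * g)) :
    N (U (f w)) ≤ 2 * N (U (f g)) + 2 * N (U (f h)) := by
  have e : f w = f g + ρ g (f h) - (ρ w (f h) + ρ w (ρ h (f g))) := by
    have h1 := congrArg f hw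
    rw [hf, hf w, hf h, map_add] at h1
    rw [h1]
    abel
  have hUρ : ∀ g v, U (ρ g v) = ρ g (U v) := fun g v => LinearMap.congr_fun (hU g).eq v
  rw [e, map_sub, map_add, map_add]
  simp only [hUρ]
  have h1 := map_sub_le_add N (U (f g) + ρ g (U (f h))) (ρ w (U (f h)) + ρ w (ρ h (U (f g))))
  have h2 := map_add_le_add N (U (f g)) (ρ g (U (f h)))
  have h3 := map_add_le_add N (ρ w (U (f h))) (ρ w (ρ h (U (f g))))
  simp only [hρ] at h2 h3
  linarith

theorem map_central_pow_mul_le (hf : IsCocycle ρ f) (hρ : ∀ g v, N (ρ g v) = N v)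
    (hab : a * b = c * (b * a)) (hc : ∀ g, Commute c g) {U : Module.End ℝ V}
    (hU : ∀ g, Commute U (ρ g)) (x y : ℕ) :
    N (U (f (c ^ (x * y)))) ≤ 2 * (x * N (U (f a))) + 2 * (y * N (U (f b))) := by
  refine (hf.map_commutator_le hρ hU (pow_mul_pow_of_central hab hc x y)).trans ?_
  gcongr
  · exact hf.map_pow_le hρ hU a x
  · exact hf.map_pow_le hρ hU b y

variable (hf : IsCocycle ρ f) (hρ : ∀ g v, N (ρ g v) = N v) (hab : a * b = c * (b * a))
  (hc : ∀ g, Commute c g) (ha : N (f a) ≤ 1) (hb : N (f b) ≤ 1)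

include hf hρ hab hc ha hb

theorem map_central_pow_mul_le_of_le_one (x y : ℕ) : N (f (c ^ (x * y))) ≤ 2 * (x + y) := by
  have h := hf.map_central_pow_mul_le hρ hab hc (U := 1) (fun g => Commute.one_left _) x y
  simp only [Module.End.one_apply] at h
  have hx : (x : ℝ) * N (f a) ≤ x * 1 := by gcongr
  have hy : (y : ℝ) * N (f b) ≤ y * 1 := by gcongr
  linarith

/-- A cocycle grows at most like the square root on the centre. -/
theorem map_central_pow_le {l i : ℕ} (hi : i < l ^ 2) : N (f (c ^ i)) ≤ 8 * l := by
  have hl : 0 < l := by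
    rcases l.eq_zero_or_pos with rfl | h
    · simp at hi
    · exact h
  have h1 : i / l < l := Nat.div_lt_of_lt_mul (by rwa [← sq])
  have h2 : i % l < l := Nat.mod_lt _ hl
  -- Both base-`l` digits of `i` are less than `l`, so the two commutator bounds add up to at most
  -- `6 * l`.
  have e : c ^ i = c ^ (i / l * l) * c ^ (i % l * 1) := by
    rw [← pow_add, mul_one, Nat.div_add_mod']
  rw [e, hf]
  refine (map_add_le_add N _ _).trans ?_
  rw [hρ]
  have h3 := hf.map_central_pow_mul_le_of_le_one hρ hab hc ha hb (i / l) l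
  have h4 := hf.map_central_pow_mul_le_of_le_one hρ hab hc ha hb (i % l) 1
  have h1' : ((i / l : ℕ) : ℝ) ≤ l := by exact_mod_cast h1.le
  have h2' : ((i % l : ℕ) : ℝ) + 1 ≤ l := by exact_mod_cast h2
  push_cast at h3 h4 h1' h2'
  have hl' : (0 : ℝ) ≤ l := by positivity
  linarith

/-- Replacing the value of a cocycle at a central element by a short central average. -/
theorem sub_ergodicAverage_le {l : ℕ} (hl : 0 < l) (m : ℕ) :
    N (f (c ^ m) - ergodicAverage (ρ c) (l ^ 2) (f (c ^ m))) ≤ 16 * l := by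
  refine N.ergodicAverage_sub_le (by positivity) fun i hi => ?_
  -- Expand `f` on the product of `c ^ m` and `c ^ i` in both orders.
  have e : f (c ^ m) - (ρ c ^ i) (f (c ^ m)) = f (c ^ i) - ρ (c ^ m) (f (c ^ i)) := by
    have h1 := hf (c ^ m) (c ^ i)
    have h2 := hf (c ^ i) (c ^ m)
    rw [← pow_add, add_comm m i, pow_add, h2] at h1
    rw [← _root_.map_pow]
    rw [sub_eq_sub_iff_add_eq_add, ← h1]
  rw [e]
  refine (map_sub_le_add N _ _).trans ?_
  rw [hρ]
  linarith [hf.map_central_pow_le hρ hab hc ha hb hi]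

/-- Long central averages of the value of a cocycle at a central element are small. -/
theorem ergodicAverage_central_pow_le {s : ℕ} (hs : 0 < s) (m : ℕ) :
    N (ergodicAverage (ρ c) (s ^ 2) (f (c ^ m))) ≤ 4 * m / s := by
  have hs' : (0 : ℝ) < s := by exact_mod_cast hs
  -- Both sides are `m` times the two commuting averages applied to `f c`. The trade replaces `c ^
  -- m` by `c ^ (s ^ 2)`, where the growth is only linear in `s`.
  have e : ergodicAverage (ρ c) (s ^ 2) (f (c ^ m)) =
      ((m : ℝ) / s ^ 2) • ergodicAverage (ρ c) m (f (c ^ (s ^ 2))) := by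
    have hcomm : Commute (ergodicAverage (ρ c) (s ^ 2)) (ergodicAverage (ρ c) m) :=
      ((Commute.refl (ρ c)).ergodicAverage_right _).symm.ergodicAverage_right m
    rw [hf.map_pow c m, hf.map_pow c (s ^ 2), map_smul, map_smul, smul_smul,
      ← Module.End.mul_apply, hcomm.eq, Module.End.mul_apply]
    congr 1
    push_cast
    field_simp
  rw [e, map_smul_eq_mul, Real.norm_of_nonneg (by positivity)]
  have h1 := N.ergodicAverage_le (hρ c) m (f (c ^ (s ^ 2)))
  have h2 := hf.map_central_pow_mul_le_of_le_one hρ hab hc ha hb s s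
  rw [← sq] at h2
  calc ((m : ℝ) / s ^ 2 : ℝ) * N (ergodicAverage (ρ c) m (f (c ^ (s ^ 2))))
      ≤ ((m : ℝ) / s ^ 2 : ℝ) * (2 * (s + s)) := by gcongr; exact h1.trans h2
    _ = 4 * (m : ℝ) / s := by field_simp; ring

/-- A cocycle into a `p`-convex space, bounded by one on the generators, is small on the central
element `c ^ (n ^ 2)` for some `n` in any long range of scales. -/
theorem exists_central_pow_le (hN : N.PConvex p K) (hp : 1 ≤ p) (hK : 0 < K) {q J : ℕ}
    (hq : 0 < q) (hJ : 0 < J) (j₀ : ℕ) :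
    ∃ j, j₀ ≤ j ∧ j < j₀ + J ∧
      N (f (c ^ (q ^ (2 * j + 1)) ^ 2)) ≤
        (q : ℝ) ^ (2 * j + 1) * (20 / q + 16 * K * (1 / J : ℝ) ^ (1 / p)) := by
  have hp0 : 0 < p := by linarith
  have hJ' : (0 : ℝ) < J := by exact_mod_cast hJ
  have hq' : (0 : ℝ) < q := by exact_mod_cast hq
  set T := ρ c with hTdef
  have hT : ∀ v, N (T v) = N v := hρ c
  have hρc : ∀ g, Commute (ρ g) T := fun g => ((hc g).map ρ).symm
  -- Adding the two generators into one potential produces a single scale that serves both.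
  let Ψ : ℕ → ℝ := fun j => N (ergodicAverage T ((q ^ 4) ^ j) (f a)) ^ p +
    N (ergodicAverage T ((q ^ 4) ^ j) (f b)) ^ p
  have hΨ0 : ∀ j, 0 ≤ Ψ j := fun j => add_nonneg
    (Real.rpow_nonneg (apply_nonneg N _) _) (Real.rpow_nonneg (apply_nonneg N _) _)
  have hΨ2 : ∀ j, Ψ j ≤ 2 := by
    intro j
    have h1 := Real.rpow_le_one (apply_nonneg N _)
      ((N.ergodicAverage_le hT ((q ^ 4) ^ j) (f a)).trans ha) hp0.le
    have h2 := Real.rpow_le_one (apply_nonneg N _)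
      ((N.ergodicAverage_le hT ((q ^ 4) ^ j) (f b)).trans hb) hp0.le
    simp only [Ψ]
    linarith
  -- Pigeonhole: the `J` successive drops telescope, and the potential stays in `[0, 2]`.
  obtain ⟨u, hu, hΔ⟩ : ∃ u ∈ range J, Ψ (j₀ + u) - Ψ (j₀ + (u + 1)) ≤ 2 / J := by
    refine exists_le_of_sum_le (nonempty_range_iff.2 hJ.ne') ?_
    rw [sum_range_sub' (fun u => Ψ (j₀ + u))]
    simp only [sum_const, card_range, nsmul_eq_mul]
    rw [mul_div_cancel₀ _ hJ'.ne']
    linarith [hΨ0 (j₀ + J), hΨ2 (j₀ + 0)]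
  rw [mem_range] at hu
  refine ⟨j₀ + u, by omega, by omega, ?_⟩
  rw [← add_assoc] at hΔ
  set j := j₀ + u with hj
  have hr : 0 < q ^ 4 := by positivity
  set k := (q ^ 4) ^ j with hk
  have hk1 : (q ^ 4) ^ (j + 1) = q ^ 4 * k := by rw [pow_succ, mul_comm]
  simp only [Ψ, hk1] at hΔ
  rw [← hk] at hΔ
  let U : ℕ → Module.End ℝ V := fun i =>
    T ^ (i * k) * ergodicAverage T k - ergodicAverage T (q ^ 4 * k)
  have hUρ : ∀ i g, Commute (U i) (ρ g) := fun i g =>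
    ((((hρc g).pow_right _).mul_right ((hρc g).ergodicAverage_right _)).sub_right
      ((hρc g).ergodicAverage_right _)).symm
  have h2K : 0 < (2 * K) ^ p := by positivity
  -- A second pigeonhole, over the blocks, again applied to the sum so that one `i` works for both
  -- `a` and `b`.
  obtain ⟨i, -, hi⟩ : ∃ i ∈ range (q ^ 4), N (U i (f a)) ^ p + N (U i (f b)) ^ p ≤
      (2 * K) ^ p * (2 / J) := by
    refine exists_le_of_sum_le (nonempty_range_iff.2 hr.ne') ?_
    rw [sum_add_distrib, sum_const, card_range, nsmul_eq_mul]
    have h1 := hN.sum_ergodicAverage_sub_le hp hK hT hr k (f a)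
    have h2 := hN.sum_ergodicAverage_sub_le hp hK hT hr k (f b)
    refine (add_le_add h1 h2).trans ?_
    rw [← mul_add, ← mul_add]
    gcongr
    linarith
  have hη : ∀ v : V, N (U i v) ^ p ≤ (2 * K) ^ p * (2 / J) →
      N (U i v) ≤ 4 * K * (1 / J : ℝ) ^ (1 / p) := by
    intro v hv
    have h1 : (2 : ℝ) ^ (1 / p) ≤ 2 := by
      conv_rhs => rw [← Real.rpow_one 2]
      exact Real.rpow_le_rpow_of_exponent_le (by norm_num) (by rw [div_le_one hp0]; exact hp)
    have h2 := Real.rpow_le_rpow (Real.rpow_nonneg (apply_nonneg N _) _) hv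
      (one_div_nonneg.2 hp0.le)
    rw [← Real.rpow_mul (apply_nonneg N _), mul_one_div_cancel hp0.ne', Real.rpow_one,
      Real.mul_rpow h2K.le (by positivity), ← Real.rpow_mul (by positivity),
      mul_one_div_cancel hp0.ne', Real.rpow_one, show (2 / J : ℝ) = 2 * (1 / J) by ring,
      Real.mul_rpow (by norm_num) (by positivity)] at h2
    calc _ ≤ _ := h2
      _ ≤ 2 * K * (2 * (1 / J : ℝ) ^ (1 / p)) := by gcongr
      _ = _ := by ring
  have hηa := hη (f a) (by linarith [Real.rpow_nonneg (apply_nonneg N (U i (f b))) p])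
  have hηb := hη (f b) (by linarith [Real.rpow_nonneg (apply_nonneg N (U i (f a))) p])
  set η := (1 / J : ℝ) ^ (1 / p)
  set n := q ^ (2 * j + 1) with hn
  have hn' : (n : ℝ) = (q : ℝ) ^ (2 * j + 1) := by rw [hn]; push_cast; rfl
  rw [← hn']
  set w := c ^ n ^ 2 with hw
  -- The side lengths of the two averaging windows are `n / q` and `n * q`, symmetric about `n = q ^
  -- (2 * j + 1)`; this explains the ratio `q ^ 4` between consecutive scales.
  have hks : k = (q ^ (2 * j)) ^ 2 := by rw [hk, ← pow_mul, ← pow_mul]; congr 1; ring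
  have hrk : q ^ 4 * k = (q ^ (2 * j + 2)) ^ 2 := by
    rw [hk, ← pow_mul, ← pow_mul, ← pow_add]; congr 1; ring
  have hshort := hf.sub_ergodicAverage_le hρ hab hc ha hb (l := q ^ (2 * j)) (by positivity)
    (n ^ 2)
  have hlong := hf.ergodicAverage_central_pow_le hρ hab hc ha hb (s := q ^ (2 * j + 2))
    (by positivity) (n ^ 2)
  rw [← hks] at hshort
  rw [← hrk] at hlong
  have hmid := hf.map_central_pow_mul_le hρ hab hc (hUρ i) n n
  rw [← sq, ← hw] at hmid
  -- The translate by `T ^ (i * k)` has the same norm, so any block may replace the initial one.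
  have hA : N (ergodicAverage T k (f w)) ≤
      N (U i (f w)) + N (ergodicAverage T (q ^ 4 * k) (f w)) := by
    have e : (T ^ (i * k)) (ergodicAverage T k (f w)) =
        U i (f w) + ergodicAverage T (q ^ 4 * k) (f w) := by
      simp [U]
    rw [← N.map_pow_of_isometry hT (i * k), e]
    exact map_add_le_add N _ _
  have hfw : N (f w) ≤ N (f w - ergodicAverage T k (f w)) + N (ergodicAverage T k (f w)) := by
    conv_lhs => rw [← sub_add_cancel (f w) (ergodicAverage T k (f w))]
    exact map_add_le_add N _ _
  have e1 : 16 * ((q ^ (2 * j) : ℕ) : ℝ) = n * (16 / q) := by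
    rw [hn']; push_cast; rw [pow_succ]; field_simp
  have e2 : 4 * ((n ^ 2 : ℕ) : ℝ) / ((q ^ (2 * j + 2) : ℕ) : ℝ) = n * (4 / q) := by
    push_cast; rw [hn', pow_succ _ (2 * j + 1)]; field_simp
  rw [e1] at hshort
  rw [e2] at hlong
  have hna := mul_le_mul_of_nonneg_left hηa (Nat.cast_nonneg (α := ℝ) n)
  have hnb := mul_le_mul_of_nonneg_left hηb (Nat.cast_nonneg (α := ℝ) n)
  have e3 : (n : ℝ) * (20 / q + 16 * K * η) =
      n * (16 / q) + n * (4 / q) + 4 * (n * (4 * K * η)) := by ring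
  rw [e3]
  linarith

end IsCocycle

/-! ### Means and Cesàro limits -/

/-- A scalar function with bounded range. -/
def IsBddFun {α : Type*} (F : α → ℝ) : Prop := ∃ C, ∀ x, |F x| ≤ C

/-- A finitely additive mean on the bounded functions on `α`. -/
structure IsMean {α : Type*} (M : (α → ℝ) → ℝ) : Prop where
  add : ∀ {F G}, IsBddFun F → IsBddFun G → M (fun x => F x + G x) = M F + M G
  smul : ∀ {F} (r : ℝ), IsBddFun F → M (fun x => r * F x) = r * M F
  mono : ∀ {F G}, IsBddFun F → IsBddFun G → (∀ x, F x ≤ G x) → M F ≤ M G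
  const : ∀ r : ℝ, M (fun _ => r) = r

namespace IsBddFun

variable {α β : Type*} {F G : α → ℝ}

theorem const (r : ℝ) : IsBddFun fun _ : α => r := ⟨|r|, fun _ => le_rfl⟩

theorem add (hF : IsBddFun F) (hG : IsBddFun G) : IsBddFun fun x => F x + G x := by
  obtain ⟨C, hC⟩ := hF
  obtain ⟨D, hD⟩ := hG
  exact ⟨C + D, fun x => (abs_add_le _ _).trans (add_le_add (hC x) (hD x))⟩

theorem const_mul (r : ℝ) (hF : IsBddFun F) : IsBddFun fun x => r * F x := by
  obtain ⟨C, hC⟩ := hF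
  exact ⟨|r| * C, fun x => by rw [abs_mul]; gcongr; exact hC x⟩

theorem comp (hF : IsBddFun F) (φ : β → α) : IsBddFun fun x => F (φ x) := by
  obtain ⟨C, hC⟩ := hF
  exact ⟨C, fun x => hC _⟩

end IsBddFun

namespace IsMean

variable {α β : Type*} {M : (α → ℝ) → ℝ} {F : α → ℝ}

theorem abs_le (hM : IsMean M) {C : ℝ} (h : ∀ x, |F x| ≤ C) : |M F| ≤ C := by
  have hF : IsBddFun F := ⟨C, h⟩
  rw [_root_.abs_le]
  constructor
  · rw [← hM.const (-C)]
    exact hM.mono (.const _) hF fun x => (_root_.abs_le.1 (h x)).1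
  · rw [← hM.const C]
    exact hM.mono hF (.const _) fun x => (_root_.abs_le.1 (h x)).2

theorem nonneg (hM : IsMean M) (hF : IsBddFun F) (h : ∀ x, 0 ≤ F x) : 0 ≤ M F := by
  rw [← hM.const 0]
  exact hM.mono (.const _) hF h

theorem le_of_le (hM : IsMean M) (hF : IsBddFun F) {r : ℝ} (h : ∀ x, F x ≤ r) : M F ≤ r := by
  rw [← hM.const r]
  exact hM.mono hF (.const _) h

theorem le_of_le' (hM : IsMean M) (hF : IsBddFun F) {r : ℝ} (h : ∀ x, r ≤ F x) : r ≤ M F := by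
  rw [← hM.const r]
  exact hM.mono (.const _) hF h

theorem isBddFun_iterate {M' : (β → ℝ) → ℝ} (hM' : IsMean M') {γ : Type*} {F : γ → ℝ}
    (hF : IsBddFun F) (φ : α → β → γ) : IsBddFun fun i => M' fun k => F (φ i k) := by
  obtain ⟨C, hC⟩ := hF
  exact ⟨C, fun i => hM'.abs_le fun k => hC _⟩

/-- Averaging a mean over a mean. -/
theorem iterate (hM : IsMean M) {M' : (β → ℝ) → ℝ} (hM' : IsMean M') {γ : Type*}
    (φ : α → β → γ) : IsMean fun F : γ → ℝ => M fun i => M' fun k => F (φ i k) where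
  add hF hG := by
    rw [← hM.add (hM'.isBddFun_iterate hF φ) (hM'.isBddFun_iterate hG φ)]
    congr 1
    funext i
    exact hM'.add (hF.comp _) (hG.comp _)
  smul r hF := by
    rw [← hM.smul r (hM'.isBddFun_iterate hF φ)]
    congr 1
    funext i
    exact hM'.smul r (hF.comp _)
  mono hF hG h := hM.mono (hM'.isBddFun_iterate hF φ) (hM'.isBddFun_iterate hG φ)
    fun i => hM'.mono (hF.comp _) (hG.comp _) fun k => h _
  const r := by simp only [hM'.const, hM.const]

end IsMean

/-- The ultrafilter limit of the Cesàro averages of a sequence. -/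
noncomputable def cesaroMean (F : ℕ → ℝ) : ℝ :=
  Filter.limUnder (Filter.hyperfilter ℕ : Filter ℕ) fun n : ℕ => ((n : ℝ) + 1)⁻¹ * ∑ i ∈ range (n + 1), F i

theorem tendsto_cesaroMean {F : ℕ → ℝ} (hF : IsBddFun F) :
    Filter.Tendsto (fun n : ℕ => ((n : ℝ) + 1)⁻¹ * ∑ i ∈ range (n + 1), F i)
      (Filter.hyperfilter ℕ : Filter ℕ) (nhds (cesaroMean F)) := by
  obtain ⟨C, hC⟩ := hF
  refine tendsto_nhds_limUnder ?_
  have hmem : ∀ n : ℕ, ((n : ℝ) + 1)⁻¹ * ∑ i ∈ range (n + 1), F i ∈ Set.Icc (-C) C := by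
    intro n
    rw [Set.mem_Icc, ← abs_le, abs_mul, abs_of_nonneg (by positivity : (0 : ℝ) ≤ (n + 1 : ℝ)⁻¹),
      inv_mul_le_iff₀ (by positivity)]
    refine (abs_sum_le_sum_abs _ _).trans ((sum_le_card_nsmul _ _ C fun i _ => hC i).trans_eq ?_)
    simp
  obtain ⟨x, -, hx⟩ := isCompact_Icc.ultrafilter_le_nhds
    ((Filter.hyperfilter ℕ).map fun n : ℕ => ((n : ℝ) + 1)⁻¹ * ∑ i ∈ range (n + 1), F i)
    (by
      rw [Filter.le_principal_iff, Ultrafilter.coe_map, Filter.mem_map]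
      exact Filter.univ_mem' hmem)
  exact ⟨x, hx⟩

theorem isMean_cesaroMean : IsMean cesaroMean where
  add hF hG := by
    refine tendsto_nhds_unique (tendsto_cesaroMean (hF.add hG)) ?_
    refine ((tendsto_cesaroMean hF).add (tendsto_cesaroMean hG)).congr fun n => ?_
    rw [sum_add_distrib, mul_add]
  smul r hF := by
    refine tendsto_nhds_unique (tendsto_cesaroMean (hF.const_mul r)) ?_
    refine ((tendsto_cesaroMean hF).const_mul r).congr fun n => ?_
    rw [← mul_sum, mul_left_comm]
  mono hF hG h := by
    refine le_of_tendsto_of_tendsto' (tendsto_cesaroMean hF) (tendsto_cesaroMean hG) fun n => ?_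
    gcongr
    exact h _
  const r := by
    refine tendsto_nhds_unique (tendsto_cesaroMean (.const r)) ?_
    refine tendsto_const_nhds.congr fun n => ?_
    simp only [sum_const, card_range, nsmul_eq_mul]
    push_cast
    field_simp

/-- A shift alters each partial sum only by two boundary terms, and the hyperfilter ignores finite
sets of indices. -/
theorem cesaroMean_succ {F : ℕ → ℝ} (hF : IsBddFun F) :
    cesaroMean (fun n => F (n + 1)) = cesaroMean F := by
  obtain ⟨C, hC⟩ := id hF
  have h := (tendsto_cesaroMean (hF.comp fun n => n + 1)).sub (tendsto_cesaroMean hF)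
  have h0 : Filter.Tendsto (fun n : ℕ => (2 * C) * ((n : ℝ) + 1)⁻¹)
      (Filter.hyperfilter ℕ : Filter ℕ) (nhds 0) := by
    have := (tendsto_one_div_add_atTop_nhds_zero_nat (𝕜 := ℝ)).const_mul (2 * C)
    simp only [one_div, mul_zero] at this
    exact this.mono_left (by rw [← Nat.cofinite_eq_atTop]; exact Filter.hyperfilter_le_cofinite)
  refine sub_eq_zero.1 (tendsto_nhds_unique h (squeeze_zero_norm (fun n => ?_) h0))
  have e : ∑ i ∈ range (n + 1), F (i + 1) - ∑ i ∈ range (n + 1), F i = F (n + 1) - F 0 := by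
    rw [← sum_sub_distrib, sum_range_sub]
  rw [← mul_sub, e, norm_mul, Real.norm_eq_abs, abs_of_nonneg (by positivity), mul_comm]
  gcongr
  refine (abs_sub _ _).trans ?_
  linarith [hC (n + 1), hC 0]

theorem cesaroMean_add {F : ℕ → ℝ} (hF : IsBddFun F) (i : ℕ) :
    cesaroMean (fun n => F (n + i)) = cesaroMean F := by
  induction i with
  | zero => rfl
  | succ i ih => rw [← ih, ← cesaroMean_succ (hF.comp fun n => n + i)]; congr 1; funext n; ring_nf

/-! ### A right-invariant mean -/

section InvariantMean

variable {G : Type*} [Group G]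

/-- The iterated Cesàro mean over the elements `c ^ k * b ^ j * a ^ i`. -/
noncomputable def iteratedMean (a b c : G) (F : G → ℝ) : ℝ :=
  cesaroMean fun i => cesaroMean fun j => cesaroMean fun k => F (c ^ k * (b ^ j * a ^ i))

variable {a b c : G}

theorem isMean_iteratedMean : IsMean (iteratedMean a b c) := by
  have h := isMean_cesaroMean.iterate (isMean_cesaroMean.iterate isMean_cesaroMean
    fun j k => ((j, k) : ℕ × ℕ)) fun i jk => c ^ jk.2 * (b ^ jk.1 * a ^ i)
  exact h

theorem iteratedMean_mul_right_a {F : G → ℝ} (hF : IsBddFun F) :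
    iteratedMean a b c (fun x => F (x * a)) = iteratedMean a b c F := by
  unfold iteratedMean
  have h := (isMean_cesaroMean.iterate isMean_cesaroMean
    fun j k => ((j, k) : ℕ × ℕ)).isBddFun_iterate (α := ℕ) hF
      fun i jk => c ^ jk.2 * (b ^ jk.1 * a ^ i)
  rw [← cesaroMean_succ h]
  simp only [mul_assoc, pow_succ]

/-- Moving `b` to the left of `a ^ i` creates `c ^ i`. Since `i` is fixed by the outermost mean, the
shift by `i` is absorbed by the innermost mean and the extra `b` by the middle one; this dictates
the order of iteration. -/
theorem iteratedMean_mul_right_b (hab : a * b = c * (b * a)) (hc : ∀ g, Commute c g) {F : G → ℝ}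
    (hF : IsBddFun F) :
    iteratedMean a b c (fun x => F (x * b)) = iteratedMean a b c F := by
  unfold iteratedMean
  congr 1
  funext i
  rw [← cesaroMean_succ
    (isMean_cesaroMean.isBddFun_iterate hF fun j k => c ^ k * (b ^ j * a ^ i))]
  congr 1
  funext j
  rw [← cesaroMean_add (hF.comp fun k => c ^ k * (b ^ (j + 1) * a ^ i)) i]
  congr 1
  funext k
  refine congrArg F ?_
  have h := pow_mul_pow_of_central hab hc i 1
  rw [mul_one, pow_one] at h
  rw [mul_assoc, mul_assoc, h, ← mul_assoc (b ^ j), ← ((hc (b ^ j)).pow_left i).eq, pow_add,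
    pow_succ b]
  simp only [mul_assoc]

theorem iteratedMean_mul_right (hab : a * b = c * (b * a)) (hc : ∀ g, Commute c g)
    (hG : Subgroup.closure {a, b} = ⊤) (g : G) {F : G → ℝ} (hF : IsBddFun F) :
    iteratedMean a b c (fun x => F (x * g)) = iteratedMean a b c F := by
  have hg : g ∈ Subgroup.closure {a, b} := by rw [hG]; trivial
  induction hg using Subgroup.closure_induction generalizing F with
  | mem x hx =>
    rcases hx with rfl | rfl
    · exact iteratedMean_mul_right_a hF
    · exact iteratedMean_mul_right_b hab hc hF
  | one => simp
  | mul x y _ _ hx hy =>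
    rw [← hy hF, ← hx (hF.comp fun z => z * y)]
    simp only [mul_assoc]
  | inv x _ hx =>
    rw [← hx (hF.comp fun z => z * x⁻¹)]
    simp

end InvariantMean

/-! ### The `L^p` seminorm of a mean and the increment cocycle -/

section BoundedFunctions

variable {α G X : Type*} [NormedAddCommGroup X] [NormedSpace ℝ X]

variable (α X) in
/-- The space of bounded functions from `α` to `X`. -/
def boundedFunctions : Submodule ℝ (α → X) where
  carrier := {F | ∃ C, ∀ x, ‖F x‖ ≤ C}
  zero_mem' := ⟨0, fun x => by simp⟩
  add_mem' := by
    rintro F G ⟨C, hC⟩ ⟨D, hD⟩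
    exact ⟨C + D, fun x => norm_add_le_of_le (hC x) (hD x)⟩
  smul_mem' := by
    rintro r F ⟨C, hC⟩
    exact ⟨‖r‖ * C, fun x => by rw [Pi.smul_apply, norm_smul]; gcongr; exact hC x⟩

theorem isBddFun_norm_rpow {p : ℝ} (hp : 0 ≤ p) (F : boundedFunctions α X) :
    IsBddFun fun x => ‖F.1 x‖ ^ p := by
  obtain ⟨C, hC⟩ := F.2
  refine ⟨C ^ p, fun x => ?_⟩
  rw [abs_of_nonneg (by positivity)]
  exact Real.rpow_le_rpow (norm_nonneg _) (hC x) hp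

variable {M : (α → ℝ) → ℝ} {p : ℝ}

theorem IsMean.rpow_norm_le (hM : IsMean M) (hp : 0 < p) (F : boundedFunctions α X) {s : ℝ}
    (hs : 0 ≤ s) : M (fun x => ‖F.1 x‖ ^ p) ^ (1 / p) ≤ s ↔ M (fun x => ‖F.1 x‖ ^ p) ≤ s ^ p := by
  have h0 := hM.nonneg (isBddFun_norm_rpow hp.le F) fun x => by positivity
  rw [one_div, Real.rpow_inv_le_iff_of_pos h0 hs hp]

/-- Minkowski's inequality for a mean. -/
theorem IsMean.rpow_norm_add_le (hM : IsMean M) (hp : 1 ≤ p) (F G : boundedFunctions α X) :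
    M (fun x => ‖(F + G).1 x‖ ^ p) ^ (1 / p) ≤
      M (fun x => ‖F.1 x‖ ^ p) ^ (1 / p) + M (fun x => ‖G.1 x‖ ^ p) ^ (1 / p) := by
  have hp0 : 0 < p := by linarith
  have hbF := isBddFun_norm_rpow hp0.le F
  have hbG := isBddFun_norm_rpow hp0.le G
  have hF := hM.nonneg hbF fun x => by positivity
  have hG := hM.nonneg hbG fun x => by positivity
  refine le_of_forall_pos_le_add fun ε hε => ?_
  -- The extra `ε / 2` makes division by `s` and `u` legitimate when a seminorm vanishes.
  set s := M (fun x => ‖F.1 x‖ ^ p) ^ (1 / p) + ε / 2 with hs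
  set u := M (fun x => ‖G.1 x‖ ^ p) ^ (1 / p) + ε / 2 with hu
  have hs0 : 0 < s := by positivity
  have hu0 : 0 < u := by positivity
  have hFs : M (fun x => ‖F.1 x‖ ^ p) ≤ s ^ p :=
    (hM.rpow_norm_le hp0 F hs0.le).1 (by linarith)
  have hGu : M (fun x => ‖G.1 x‖ ^ p) ≤ u ^ p :=
    (hM.rpow_norm_le hp0 G hu0.le).1 (by linarith)
  have hsu : M (fun x => ‖(F + G).1 x‖ ^ p) ^ (1 / p) ≤ s + u := by
    rw [hM.rpow_norm_le hp0 _ (by positivity)]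
    -- Convexity of the `p`-th power at the normalised norms, with weights `s / (s + u)` and `u / (s
    -- + u)`.
    have hpt : ∀ x, ‖(F + G).1 x‖ ^ p ≤
        ((s + u) ^ p * (s / (s + u)) / s ^ p) * ‖F.1 x‖ ^ p +
          ((s + u) ^ p * (u / (s + u)) / u ^ p) * ‖G.1 x‖ ^ p := by
      intro x
      have hconv := (convexOn_rpow hp).2
        (Set.mem_Ici.2 (by positivity : 0 ≤ ‖F.1 x‖ / s))
        (Set.mem_Ici.2 (by positivity : 0 ≤ ‖G.1 x‖ / u))
        (by positivity : 0 ≤ s / (s + u)) (by positivity : 0 ≤ u / (s + u)) (by field_simp)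
      simp only [smul_eq_mul] at hconv
      rw [Real.div_rpow (norm_nonneg _) hs0.le, Real.div_rpow (norm_nonneg _) hu0.le] at hconv
      have e : s / (s + u) * (‖F.1 x‖ / s) + u / (s + u) * (‖G.1 x‖ / u) =
          (‖F.1 x‖ + ‖G.1 x‖) / (s + u) := by field_simp
      rw [e, Real.div_rpow (by positivity) (by positivity), div_le_iff₀ (by positivity)] at hconv
      calc ‖(F + G).1 x‖ ^ p ≤ (‖F.1 x‖ + ‖G.1 x‖) ^ p :=
            Real.rpow_le_rpow (norm_nonneg _) (norm_add_le _ _) hp0.le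
        _ ≤ _ := hconv
        _ = _ := by ring
    refine (hM.mono (isBddFun_norm_rpow hp0.le _) ((hbF.const_mul _).add (hbG.const_mul _))
      hpt).trans ?_
    rw [hM.add (hbF.const_mul _) (hbG.const_mul _), hM.smul _ hbF, hM.smul _ hbG]
    calc _ ≤ ((s + u) ^ p * (s / (s + u)) / s ^ p) * s ^ p +
          ((s + u) ^ p * (u / (s + u)) / u ^ p) * u ^ p := by gcongr
      _ = _ := by field_simp
  linarith

/-- The `L^p` seminorm of a mean on bounded functions. -/
noncomputable def IsMean.seminorm (hM : IsMean M) (hp : 1 ≤ p) :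
    Seminorm ℝ (boundedFunctions α X) :=
  Seminorm.of (fun F => M (fun x => ‖F.1 x‖ ^ p) ^ (1 / p)) (hM.rpow_norm_add_le hp) (by
    intro r F
    have hp0 : 0 < p := by linarith
    have h0 := hM.nonneg (isBddFun_norm_rpow hp0.le F) fun x => by positivity
    have e : (fun x => ‖(r • F).1 x‖ ^ p) = fun x => ‖r‖ ^ p * ‖F.1 x‖ ^ p := by
      funext x
      rw [Submodule.coe_smul, Pi.smul_apply, norm_smul,
        Real.mul_rpow (norm_nonneg _) (norm_nonneg _)]
    rw [e, hM.smul _ (isBddFun_norm_rpow hp0.le F), Real.mul_rpow (by positivity) h0,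
      ← Real.rpow_mul (norm_nonneg _), mul_one_div_cancel hp0.ne', Real.rpow_one])

theorem IsMean.seminorm_apply (hM : IsMean M) (hp : 1 ≤ p) (F : boundedFunctions α X) :
    hM.seminorm hp F = M (fun x => ‖F.1 x‖ ^ p) ^ (1 / p) := rfl

theorem IsMean.seminorm_rpow (hM : IsMean M) (hp : 1 ≤ p) (F : boundedFunctions α X) :
    hM.seminorm hp F ^ p = M (fun x => ‖F.1 x‖ ^ p) := by
  have hp0 : 0 < p := by linarith
  have h0 := hM.nonneg (isBddFun_norm_rpow hp0.le F) fun x => by positivity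
  rw [hM.seminorm_apply, ← Real.rpow_mul h0, one_div_mul_cancel hp0.ne', Real.rpow_one]

theorem IsMean.seminorm_le (hM : IsMean M) (hp : 1 ≤ p) (F : boundedFunctions α X) {r : ℝ}
    (hr : 0 ≤ r) (h : ∀ x, ‖F.1 x‖ ≤ r) : hM.seminorm hp F ≤ r := by
  have hp0 : 0 < p := by linarith
  rw [hM.seminorm_apply, hM.rpow_norm_le hp0 F hr]
  exact hM.le_of_le (isBddFun_norm_rpow hp0.le F) fun x =>
    Real.rpow_le_rpow (norm_nonneg _) (h x) hp0.le

theorem IsMean.le_seminorm (hM : IsMean M) (hp : 1 ≤ p) (F : boundedFunctions α X) {r : ℝ}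
    (hr : 0 ≤ r) (h : ∀ x, r ≤ ‖F.1 x‖) : r ≤ hM.seminorm hp F := by
  have hp0 : 0 < p := by linarith
  have h0 := hM.nonneg (isBddFun_norm_rpow hp0.le F) fun x => by positivity
  rw [hM.seminorm_apply, one_div, Real.le_rpow_inv_iff_of_pos hr h0 hp0]
  exact hM.le_of_le' (isBddFun_norm_rpow hp0.le F) fun x => Real.rpow_le_rpow hr (h x) hp0.le

/-- The `L^p` seminorm of a mean inherits `p`-convexity from the target. -/
theorem IsMean.pConvex_seminorm (hM : IsMean M) (hp : 1 ≤ p) {K : ℝ} (hX : PConvexIneq X p K) :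
    (hM.seminorm hp : Seminorm ℝ (boundedFunctions α X)).PConvex p K := by
  have hp0 : 0 ≤ p := by linarith
  intro F G
  simp only [hM.seminorm_rpow]
  have hb := isBddFun_norm_rpow (α := α) (X := X) hp0
  have hs := (hb ((2⁻¹ : ℝ) • (F - G))).const_mul (1 / K ^ p)
  have h := hM.mono ((hb ((2⁻¹ : ℝ) • (F + G))).add hs)
    (((hb F).add (hb G)).const_mul 2⁻¹) fun x => by
      have := hX (F.1 x) (G.1 x)
      simp only [Submodule.coe_smul, Submodule.coe_add, Submodule.coe_sub, Pi.smul_apply,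
        Pi.add_apply, Pi.sub_apply]
      linarith
  rw [hM.add (hb _) hs, hM.smul _ (hb _), hM.smul _ ((hb F).add (hb G)),
    hM.add (hb F) (hb G)] at h
  linarith

variable [Group G]

variable (G X) in
/-- The action of a group on the bounded functions by right translations. -/
def rightTranslation : G →* Module.End ℝ (boundedFunctions G X) where
  toFun g :=
    { toFun := fun F => ⟨fun x => F.1 (x * g), F.2.imp fun _ hC x => hC _⟩
      map_add' := fun _ _ => rfl
      map_smul' := fun _ _ => rfl }
  map_one' := by
    ext F x
    simp
  map_mul' g h := by
    ext F x
    simp [mul_assoc]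

theorem rightTranslation_apply (g : G) (F : boundedFunctions G X) (x : G) :
    (rightTranslation G X g F).1 x = F.1 (x * g) := rfl

theorem IsMean.seminorm_rightTranslation {M : (G → ℝ) → ℝ} (hM : IsMean M) (hp : 1 ≤ p)
    (hinv : ∀ (g : G) {F : G → ℝ}, IsBddFun F → M (fun x => F (x * g)) = M F) (g : G)
    (F : boundedFunctions G X) :
    hM.seminorm hp (rightTranslation G X g F) = hM.seminorm hp F := by
  rw [hM.seminorm_apply, hM.seminorm_apply,
    ← hinv g (isBddFun_norm_rpow (by linarith : (0 : ℝ) ≤ p) F)]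
  rfl

/-- The increments `x ↦ f (x * g) - f x` of a function form a cocycle. -/
theorem isCocycle_increment {f : G → X} (hf : ∀ g, ∃ C, ∀ x, ‖f (x * g) - f x‖ ≤ C) :
    IsCocycle (rightTranslation G X)
      fun g => (⟨fun x => f (x * g) - f x, hf g⟩ : boundedFunctions G X) := by
  intro g h
  ext x
  simp [rightTranslation_apply, mul_assoc]

end BoundedFunctions

/-! ### Word length on the centre and the compression estimate -/

namespace Heisenberg

/-- The central element `a b a⁻¹ b⁻¹`. -/
def c : Heisenberg := a * b * a⁻¹ * b⁻¹

theorem commute_c (g : Heisenberg) : Commute c g := by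
  obtain ⟨w, rfl⟩ := PresentedGroup.mk_surjective heisenbergRels g
  have h := PresentedGroup.one_of_mem (rels := heisenbergRels) ⟨w, rfl⟩
  simp only [map_mul, map_inv] at h
  have h' : c * PresentedGroup.mk heisenbergRels w * c⁻¹ *
      (PresentedGroup.mk heisenbergRels w)⁻¹ = 1 := h
  rwa [mul_inv_eq_one, mul_inv_eq_iff_eq_mul] at h'

theorem a_mul_b : a * b = c * (b * a) := by
  simp [c, mul_assoc]

theorem closure_a_b : Subgroup.closure {a, b} = (⊤ : Subgroup Heisenberg) := by
  rw [← PresentedGroup.closure_range_of heisenbergRels]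
  congr 1
  ext x
  simp only [Set.mem_insert_iff, Set.mem_singleton_iff, Set.mem_range, Fin.exists_fin_two]
  exact or_congr eq_comm eq_comm

theorem wordLength_prod_le (l : List Heisenberg) (hl : ∀ s ∈ l, s ∈ S) :
    wordLength l.prod ≤ l.length :=
  Nat.sInf_le ⟨l, hl, rfl, rfl⟩

theorem wordLength_c_pow_sq_le (n : ℕ) : wordLength (c ^ n ^ 2) ≤ 4 * n := by
  have h := pow_mul_pow_of_central a_mul_b commute_c n n
  have e : c ^ n ^ 2 = (List.replicate n a ++ List.replicate n b ++ List.replicate n a⁻¹ ++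
      List.replicate n b⁻¹).prod := by
    simp only [List.prod_append, List.prod_replicate]
    rw [h, sq, inv_pow, inv_pow]
    group
  rw [e]
  refine (wordLength_prod_le _ fun s hs => ?_).trans_eq ?_
  · simp only [List.mem_append, List.mem_replicate] at hs
    simp only [S, Set.mem_insert_iff, Set.mem_singleton_iff]
    tauto
  · simp only [List.length_append, List.length_replicate]
    ring

/-- The shear `(y, z) ↦ (y, z + y)` and the translation `(y, z) ↦ (y + 1, z)`. -/
def planeGenerator (i : Fin 2) : Equiv.Perm (ℤ × ℤ) :=
  if i = 0 then
    { toFun := fun v => (v.1, v.2 + v.1)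
      invFun := fun v => (v.1, v.2 - v.1)
      left_inv := fun v => by simp
      right_inv := fun v => by simp }
  else
    { toFun := fun v => (v.1 + 1, v.2)
      invFun := fun v => (v.1 - 1, v.2)
      left_inv := fun v => by simp
      right_inv := fun v => by simp }

/-- The vertical translation of the plane. -/
def verticalTranslation : Equiv.Perm (ℤ × ℤ) where
  toFun v := (v.1, v.2 + 1)
  invFun v := (v.1, v.2 - 1)
  left_inv v := by simp
  right_inv v := by simp

theorem planeGenerator_commutator :
    planeGenerator 0 * planeGenerator 1 * (planeGenerator 0)⁻¹ * (planeGenerator 1)⁻¹ =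
      verticalTranslation := by
  rw [mul_inv_eq_iff_eq_mul, mul_inv_eq_iff_eq_mul]
  ext v
  · simp [planeGenerator, verticalTranslation]
  · simp [planeGenerator, verticalTranslation]
    ring

theorem commute_verticalTranslation (g : FreeGroup (Fin 2)) :
    Commute verticalTranslation (FreeGroup.lift planeGenerator g) := by
  have hgen : ∀ i, Commute verticalTranslation (planeGenerator i) := by
    intro i
    ext v
    · fin_cases i <;> simp [planeGenerator, verticalTranslation]
    · fin_cases i <;> simp [planeGenerator, verticalTranslation]
      ring
  induction g using FreeGroup.induction_on with
  | C1 => simp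
  | of i => simpa using hgen i
  | inv_of i _ => simpa using (hgen i).inv_right
  | mul x y hx hy => rw [map_mul]; exact hx.mul_right hy

/-- The action of the Heisenberg group on the plane. -/
def planeAction : Heisenberg →* Equiv.Perm (ℤ × ℤ) :=
  PresentedGroup.toGroup (f := planeGenerator) (by
    rintro r ⟨g, rfl⟩
    simp only [map_mul, map_inv, FreeGroup.lift_apply_of]
    rw [planeGenerator_commutator, (commute_verticalTranslation g).eq]
    simp)

theorem planeAction_a : planeAction a = planeGenerator 0 := PresentedGroup.toGroup.of _

theorem planeAction_b : planeAction b = planeGenerator 1 := PresentedGroup.toGroup.of _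

theorem planeAction_c : planeAction c = verticalTranslation := by
  rw [← planeGenerator_commutator, c, map_mul, map_mul, map_mul, map_inv, map_inv, planeAction_a,
    planeAction_b]

theorem planeAction_c_pow (m : ℕ) : planeAction (c ^ m) (0, 0) = (0, (m : ℤ)) := by
  induction m with
  | zero => simp
  | succ m ih =>
    rw [pow_succ', map_mul, Equiv.Perm.mul_apply, ih, planeAction_c]
    simp [verticalTranslation]

/-- A word of length `n` moves the origin by at most `n` horizontally and `n ^ 2` vertically. -/
theorem abs_planeAction_prod_le (l : List Heisenberg) (hl : ∀ s ∈ l, s ∈ S) :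
    |(planeAction l.prod (0, 0)).1| ≤ l.length ∧
      |(planeAction l.prod (0, 0)).2| ≤ (l.length : ℤ) ^ 2 := by
  induction l with
  | nil => simp
  | cons s l ih =>
    obtain ⟨h1, h2⟩ := ih fun s hs => hl s (List.mem_cons_of_mem _ hs)
    rw [List.prod_cons, map_mul, Equiv.Perm.mul_apply, List.length_cons]
    generalize planeAction l.prod (0, 0) = v at h1 h2
    obtain ⟨y, z⟩ := v
    have hs := hl s List.mem_cons_self
    have hs' : (planeAction s (y, z)).1 = y ∧ |(planeAction s (y, z)).2| ≤ |z| + |y| ∨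
        |(planeAction s (y, z)).1| ≤ |y| + 1 ∧ (planeAction s (y, z)).2 = z := by
      rcases hs with rfl | rfl | rfl | rfl
      · left
        rw [planeAction_a]
        exact ⟨rfl, abs_add_le _ _⟩
      · right
        rw [planeAction_b]
        exact ⟨(abs_add_le _ _).trans_eq (by simp), rfl⟩
      · left
        rw [map_inv, planeAction_a]
        exact ⟨rfl, abs_sub _ _⟩
      · right
        rw [map_inv, planeAction_b]
        exact ⟨(abs_sub _ _).trans_eq (by simp), rfl⟩
    push_cast
    simp only at h1 h2
    rcases hs' with ⟨e1, e2⟩ | ⟨e1, e2⟩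
    · rw [e1]
      exact ⟨by linarith, by nlinarith⟩
    · rw [e2]
      exact ⟨by linarith, by nlinarith⟩

/-- In the plane action `c ^ n ^ 2` lifts the origin by `n ^ 2`, while a word of length `m` can lift
it by at most `m ^ 2`. -/
theorem le_wordLength_c_pow_sq (n : ℕ) : n ≤ wordLength (c ^ n ^ 2) := by
  obtain ⟨l, hl, hp, hlen⟩ := exists_word (c ^ n ^ 2)
  have h := (abs_planeAction_prod_le l hl).2
  rw [hp, planeAction_c_pow, hlen, Nat.abs_cast] at h
  have h' : n ^ 2 ≤ wordLength (c ^ n ^ 2) ^ 2 := by exact_mod_cast h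
  exact (Nat.pow_le_pow_iff_left two_ne_zero).1 h'

theorem wordLength_le_one {s : Heisenberg} (hs : s ∈ S) : wordLength s ≤ 1 := by
  have h := wordLength_prod_le [s] (by simpa using hs)
  simpa using h

theorem compression_le {X : Type*} [NormedAddCommGroup X] (f : Heisenberg → X)
    {n : ℕ} {x y : Heisenberg} (h : wordDist x y = n) : compression f n ≤ ‖f x - f y‖ :=
  (le_compression_iff f n _).1 le_rfl x y h

/-- Compression bound for a Lipschitz function at some distance within a constant factor of some
power `q ^ (2 j + 1)`. -/
theorem exists_compression_le {X : Type*} [NormedAddCommGroup X] [NormedSpace ℝ X] {p K : ℝ}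
    (hp : 1 ≤ p) (hK : 0 < K) (hX : PConvexIneq X p K) {f : Heisenberg → X}
    (hf : ∀ x y : Heisenberg, ‖f x - f y‖ ≤ (wordDist x y : ℝ)) {q J : ℕ} (hq : 0 < q)
    (hJ : 0 < J) (j₀ : ℕ) :
    ∃ j d : ℕ, j₀ ≤ j ∧ j < j₀ + J ∧ q ^ (2 * j + 1) ≤ d ∧ d ≤ 4 * q ^ (2 * j + 1) ∧
      compression f d / d ≤ 20 / q + 16 * K * (1 / J : ℝ) ^ (1 / p) := by
  have hM : IsMean (iteratedMean a b c) := isMean_iteratedMean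
  have hfg : ∀ g x, ‖f (x * g) - f x‖ ≤ (wordLength g : ℝ) := fun g x => by
    rw [norm_sub_rev]
    simpa [wordDist] using hf x (x * g)
  have hcoc := isCocycle_increment (G := Heisenberg) (f := f) fun g => ⟨_, hfg g⟩
  have hgen : ∀ s ∈ S, hM.seminorm hp (⟨fun x => f (x * s) - f x, ⟨_, hfg s⟩⟩ :
      boundedFunctions Heisenberg X) ≤ 1 := fun s hs =>
    hM.seminorm_le hp _ zero_le_one fun x =>
      (hfg s x).trans (by exact_mod_cast wordLength_le_one hs)
  obtain ⟨j, hj, hj', h⟩ := hcoc.exists_central_pow_le (N := hM.seminorm hp)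
    (hM.seminorm_rightTranslation hp fun g _ hF =>
      iteratedMean_mul_right a_mul_b commute_c closure_a_b g hF)
    a_mul_b commute_c (hgen a (by simp [S])) (hgen b (by simp [S]))
    (hM.pConvex_seminorm hp hX) hp hK hq hJ j₀
  set n := q ^ (2 * j + 1) with hn
  have hn0 : 0 < n := by positivity
  have hn' : (q : ℝ) ^ (2 * j + 1) = n := by rw [hn]; push_cast; rfl
  rw [hn'] at h
  have hlow := le_wordLength_c_pow_sq n
  refine ⟨j, wordLength (c ^ n ^ 2), hj, hj', hlow, wordLength_c_pow_sq_le n, ?_⟩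
  have hd : (n : ℝ) ≤ wordLength (c ^ n ^ 2) := by exact_mod_cast hlow
  have hn0' : (0 : ℝ) < n := by exact_mod_cast hn0
  have h0 : 0 ≤ compression f (wordLength (c ^ n ^ 2)) :=
    (le_compression_iff f _ _).2 fun x y _ => norm_nonneg _
  -- Every `x` and `x * c ^ n ^ 2` lie at the same word distance, so the compression bounds the
  -- increment from below pointwise, hence in seminorm.
  have hle := (hM.le_seminorm hp (⟨fun x => f (x * c ^ n ^ 2) - f x, ⟨_, hfg _⟩⟩ :
    boundedFunctions Heisenberg X) h0 fun x => by
      rw [norm_sub_rev]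
      exact compression_le f (by simp [wordDist])).trans h
  rw [div_le_iff₀ (by linarith), mul_comm]
  exact hle.trans (by gcongr)

end Heisenberg

/-! ### The convexity constant -/

theorem one_le_of_pConvexIneq {X : Type*} [NormedAddCommGroup X] [NormedSpace ℝ X] [Nontrivial X]
    {p K : ℝ} (hp : 0 < p) (hK : 0 < K) (h : PConvexIneq X p K) : 1 ≤ K := by
  obtain ⟨x, hx⟩ := exists_ne (0 : X)
  -- Antipodal points have midpoint zero, so the convexity defect cannot exceed `‖x‖ ^ p`.
  have h1 := h x (-x)
  have e : (2⁻¹ : ℝ) • (x - -x) = x := by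
    rw [sub_neg_eq_add, ← two_smul ℝ, smul_smul, inv_mul_cancel₀ two_ne_zero, one_smul]
  rw [e, add_neg_cancel, smul_zero, norm_zero, norm_neg, Real.zero_rpow hp.ne'] at h1
  have hx' : 0 < ‖x‖ ^ p := Real.rpow_pos_of_pos (norm_pos_iff.2 hx) p
  have h2 : 1 / K ^ p ≤ 1 := by
    by_contra! hlt
    nlinarith
  rw [div_le_one (by positivity)] at h2
  by_contra! hlt
  exact absurd (Real.rpow_lt_one hK.le hlt hp) (not_lt.2 h2)

/-- The infimum is positive, so an admissible `K` within a factor 2 exists without knowing that the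
infimum is attained. -/
theorem exists_pConvexIneq_le_two_mul {X : Type*} [NormedAddCommGroup X] [NormedSpace ℝ X]
    [Nontrivial X] {p : ℝ} (hp : 0 < p) (h : ∃ K : ℝ, 0 < K ∧ PConvexIneq X p K) :
    1 ≤ pConvexityConst X p ∧
      ∃ K, 0 < K ∧ PConvexIneq X p K ∧ K ≤ 2 * pConvexityConst X p := by
  have h1 : 1 ≤ pConvexityConst X p :=
    le_csInf h fun K hK => one_le_of_pConvexIneq hp hK.1 hK.2
  obtain ⟨K, hK, hlt⟩ := exists_lt_of_csInf_lt (s := {K : ℝ | 0 < K ∧ PConvexIneq X p K}) h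
    (show pConvexityConst X p < 2 * pConvexityConst X p by linarith)
  exact ⟨h1, K, hK.1, hK.2, hlt.le⟩

/-! ### Choice of scales -/

section Scales

theorem log_le_div_four {x : ℝ} (hx : 16 ≤ x) : Real.log x ≤ x / 4 := by
  have h1 : Real.log (x / 16) ≤ x / 16 - 1 := Real.log_le_sub_one_of_pos (by positivity)
  rw [Real.log_div (by positivity) (by norm_num), show (16 : ℝ) = 2 ^ 4 by norm_num,
    Real.log_pow] at h1
  have := Real.log_two_lt_d9
  push_cast at h1
  linarith

/-- The double-logarithmic ratio is almost monotone on `[t, t ^ 2]`. -/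
theorem log_log_div_log_le {t d : ℝ} (ht : 3 ≤ t) (h1 : t ≤ d) (h2 : d ≤ t ^ 2) :
    Real.log (Real.log t) / Real.log t / 2 ≤ Real.log (Real.log d) / Real.log d ∧
      0 < Real.log (Real.log t) := by
  have hlt : 1 < Real.log t := by
    rw [Real.lt_log_iff_exp_lt (by linarith)]
    linarith [Real.exp_one_lt_d9]
  have hld : Real.log t ≤ Real.log d := Real.log_le_log (by linarith) h1
  have hld2 : Real.log d ≤ 2 * Real.log t := by
    have := Real.log_le_log (by linarith) h2
    rwa [Real.log_pow, Nat.cast_two] at this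
  have hll : Real.log (Real.log t) ≤ Real.log (Real.log d) :=
    Real.log_le_log (by linarith) hld
  have hpos : 0 < Real.log (Real.log t) := Real.log_pos hlt
  refine ⟨?_, hpos⟩
  rw [div_div, div_le_div_iff₀ (by linarith) (by linarith)]
  nlinarith

/-- Choice of the base `q` and of the number `J` of scales. -/
theorem exists_scales {t : ℝ} (ht : Real.exp 16 ≤ t) :
    ∃ q J j₀ : ℕ, 0 < q ∧ 0 < J ∧ Real.sqrt (Real.log t) ≤ q ∧
      Real.log t / (8 * Real.log (Real.log t)) ≤ J ∧
      ∀ j, j₀ ≤ j → j < j₀ + J → t ≤ (q : ℝ) ^ (2 * j + 1) ∧ 4 * (q : ℝ) ^ (2 * j + 1) ≤ t ^ 2 := by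
  have ht0 : 0 < t := (Real.exp_pos _).trans_le ht
  set x := Real.log t with hx
  have hx16 : 16 ≤ x := (Real.le_log_iff_exp_le ht0).2 ht
  have hlx4 := log_le_div_four hx16
  have hlx1 : 1 < Real.log x := by
    rw [Real.lt_log_iff_exp_lt (by linarith)]
    linarith [Real.exp_one_lt_d9]
  have hsq : Real.sqrt x ^ 2 = x := Real.sq_sqrt (by linarith)
  have hs4 : 4 ≤ Real.sqrt x := Real.le_sqrt_of_sq_le (by linarith)
  set q := ⌈Real.sqrt x⌉₊ with hq
  have hq1 : Real.sqrt x ≤ q := Nat.le_ceil _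
  have hqx : (q : ℝ) ≤ x := by
    have := (Nat.ceil_lt_add_one (Real.sqrt_nonneg x)).le
    nlinarith
  have hq0 : (1 : ℝ) < q := by linarith
  have htq : t = Real.exp x := (Real.exp_log ht0).symm
  have hJ1 : 1 ≤ x / (4 * Real.log x) := by
    rw [le_div_iff₀ (by linarith)]
    linarith
  set J := ⌊x / (4 * Real.log x)⌋₊ with hJ
  have hJ0 : 0 < J := Nat.floor_pos.2 hJ1
  have hJle : (J : ℝ) ≤ x / (4 * Real.log x) := Nat.floor_le (by linarith)
  have hJlt : x / (4 * Real.log x) < J + 1 := Nat.lt_floor_add_one _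
  have hex : ∃ j : ℕ, t ≤ (q : ℝ) ^ (2 * j + 1) := by
    obtain ⟨n, hn⟩ := pow_unbounded_of_one_lt t hq0
    exact ⟨n, hn.le.trans (pow_le_pow_right₀ hq0.le (by omega))⟩
  -- The choice of `J` and `q ≤ x` make `q ^ (2 * J)` at most `exp (x / 2) = √t`; the other factor
  -- `√t` covers the 4.
  have hqJ : 4 * (q : ℝ) ^ (2 * J) ≤ t := by
    have h1 : (q : ℝ) ^ (2 * J) ≤ Real.exp (x / 2) := by
      calc (q : ℝ) ^ (2 * J) ≤ x ^ (2 * J) := by gcongr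
        _ = Real.exp (Real.log x * ((2 * J : ℕ) : ℝ)) := by
          rw [← Real.rpow_natCast, Real.rpow_def_of_pos (by linarith)]
        _ ≤ Real.exp (x / 2) := by
          rw [Real.exp_le_exp]
          push_cast
          rw [le_div_iff₀ (by linarith)] at hJle
          linarith
    have h2 : 4 ≤ Real.exp (x / 2) := by linarith [Real.add_one_le_exp (x / 2)]
    have h3 : t = Real.exp (x / 2) * Real.exp (x / 2) := by
      rw [← Real.exp_add, htq]; congr 1; ring
    rw [h3]
    gcongr
  refine ⟨q, J, Nat.find hex, by positivity, hJ0, hq1, ?_, fun j hj hj' => ⟨?_, ?_⟩⟩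
  · have h1 : (1 : ℝ) ≤ J := by exact_mod_cast hJ0
    have h2 : x / (8 * Real.log x) = x / (4 * Real.log x) / 2 := by
      rw [div_div]; congr 1; ring
    rw [h2]
    linarith
  · exact (Nat.find_spec hex).trans (pow_le_pow_right₀ hq0.le (by omega))
  · have hbase : (q : ℝ) ^ (2 * Nat.find hex + 1) ≤ t * (q : ℝ) ^ 2 := by
      rcases Nat.eq_zero_or_pos (Nat.find hex) with h0 | h0
      · rw [h0, mul_zero, zero_add, pow_one]
        have : 1 ≤ t := by rw [htq]; exact Real.one_le_exp (by linarith)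
        nlinarith
      · have h1 := Nat.find_min hex (Nat.sub_lt h0 one_pos)
        rw [not_le] at h1
        calc (q : ℝ) ^ (2 * Nat.find hex + 1)
            = (q : ℝ) ^ (2 * (Nat.find hex - 1) + 1) * (q : ℝ) ^ 2 := by
              rw [← pow_add]; congr 1; omega
          _ ≤ t * (q : ℝ) ^ 2 := by gcongr
    calc 4 * (q : ℝ) ^ (2 * j + 1)
        ≤ 4 * (q : ℝ) ^ (2 * Nat.find hex + 1 + 2 * (J - 1)) := by
          refine mul_le_mul_of_nonneg_left (pow_le_pow_right₀ hq0.le ?_) (by norm_num)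
          omega
      _ = 4 * ((q : ℝ) ^ (2 * Nat.find hex + 1) * (q : ℝ) ^ (2 * (J - 1))) := by rw [pow_add]
      _ ≤ 4 * (t * (q : ℝ) ^ 2 * (q : ℝ) ^ (2 * (J - 1))) := by gcongr
      _ = t * (4 * (q : ℝ) ^ (2 * J)) := by
          have : 2 * J = 2 + 2 * (J - 1) := by omega
          rw [this, pow_add]
          ring
      _ ≤ t * t := by gcongr
      _ = t ^ 2 := (sq t).symm

end Scales

/-! ### Small `t` and the conclusion -/

theorem compression_le_self {X : Type*} [NormedAddCommGroup X] {f : Heisenberg → X}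
    (hf : ∀ x y : Heisenberg, ‖f x - f y‖ ≤ (Heisenberg.wordDist x y : ℝ)) (n : ℕ) :
    Heisenberg.compression f n ≤ n := by
  obtain ⟨x, y, h⟩ := Heisenberg.exists_wordDist_eq n
  exact (Heisenberg.compression_le f h).trans ((hf x y).trans_eq (by rw [h]))

theorem exists_nat_mem_Icc_sq {t : ℝ} (ht : 3 ≤ t) : ∃ n : ℕ, t ≤ (n : ℝ) ∧ (n : ℝ) ≤ t ^ 2 := by
  refine ⟨⌈t⌉₊, Nat.le_ceil t, ?_⟩
  have := Nat.ceil_lt_add_one (by linarith : 0 ≤ t)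
  nlinarith

/-- Compression bound in the range where `log t` is bounded. -/
theorem exists_compression_le_of_le_exp {X : Type*} [NormedAddCommGroup X] {p κ : ℝ}
    (hp : 1 ≤ p) (hκ : 1 ≤ κ) {f : Heisenberg → X}
    (hf : ∀ x y : Heisenberg, ‖f x - f y‖ ≤ (Heisenberg.wordDist x y : ℝ)) {t : ℝ} (ht : 3 ≤ t)
    (ht' : t ≤ Real.exp 16) :
    ∃ n : ℕ, t ≤ (n : ℝ) ∧ (n : ℝ) ≤ t ^ 2 ∧ Heisenberg.compression f (n : ℝ) / (n : ℝ) ≤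
      (32 / Real.log (Real.log 3) + 1) * κ *
        (Real.log (Real.log (n : ℝ)) / Real.log (n : ℝ)) ^ (1 / p) := by
  obtain ⟨n, h1, h2⟩ := exists_nat_mem_Icc_sq ht
  refine ⟨n, h1, h2, ?_⟩
  have hn3 : (3 : ℝ) ≤ n := ht.trans h1
  have hL := (log_log_div_log_le le_rfl le_rfl (by norm_num)).2
  have hlog3 : 1 < Real.log 3 := by
    rw [Real.lt_log_iff_exp_lt (by norm_num)]
    linarith [Real.exp_one_lt_d9]
  have hln : Real.log 3 ≤ Real.log n := Real.log_le_log (by norm_num) hn3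
  have hln32 : Real.log n ≤ 32 := by
    rw [Real.log_le_iff_le_exp (by linarith)]
    calc (n : ℝ) ≤ t ^ 2 := h2
      _ ≤ Real.exp 16 ^ 2 := by gcongr
      _ = Real.exp 32 := by rw [← Real.exp_nat_mul]; norm_num
  have hll : Real.log (Real.log 3) ≤ Real.log (Real.log n) := Real.log_le_log (by linarith) hln
  set L := Real.log (Real.log 3) with hLdef
  -- Here `log n ≤ 32`, so `ρ` bounds the ratio below. As `ρ ≤ 1`, it also bounds the `1 / p`-th
  -- power, uniformly in `p`.
  set ρ := L / 32 with hρ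
  have hρ0 : 0 < ρ := by positivity
  have hρr : ρ ≤ Real.log (Real.log n) / Real.log n := by
    rw [hρ, div_le_div_iff₀ (by norm_num) (by linarith)]
    nlinarith
  have hρ1 : ρ ≤ 1 := by
    have : Real.log (Real.log n) ≤ Real.log n := Real.log_le_self (by linarith)
    exact hρr.trans (div_le_one_of_le₀ this (by linarith))
  have hpow : ρ ≤ (Real.log (Real.log n) / Real.log n) ^ (1 / p) := by
    calc ρ = ρ ^ (1 : ℝ) := (Real.rpow_one ρ).symm
      _ ≤ ρ ^ (1 / p) := Real.rpow_le_rpow_of_exponent_ge hρ0 hρ1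
          ((div_le_one (by linarith)).2 hp)
      _ ≤ _ := Real.rpow_le_rpow hρ0.le hρr (by positivity)
  have hone : Heisenberg.compression f (n : ℝ) / (n : ℝ) ≤ 1 :=
    div_le_one_of_le₀ (compression_le_self hf n) (by linarith)
  calc _ ≤ (1 : ℝ) := hone
    _ = 32 / L * 1 * ρ := by rw [hρ]; field_simp
    _ ≤ (32 / L + 1) * κ * ρ := by gcongr; linarith
    _ ≤ _ := by gcongr

theorem theorem1p2 :
    ∃ C : ℝ, 0 < C ∧
      ∀ (p : ℝ), 2 ≤ p →
      ∀ (X : Type*) [NormedAddCommGroup X] [NormedSpace ℝ X] [CompleteSpace X],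
      (∃ K : ℝ, 0 < K ∧ PConvexIneq X p K) →
      ∀ f : Heisenberg → X,
      (∀ x y : Heisenberg, ‖f x - f y‖ ≤ (Heisenberg.wordDist x y : ℝ)) →
      ∀ t : ℝ, 3 ≤ t →
      ∃ n : ℕ, t ≤ (n : ℝ) ∧ (n : ℝ) ≤ t ^ 2 ∧
        Heisenberg.compression f (n : ℝ) / (n : ℝ) ≤
          C * pConvexityConst X p *
            (Real.log (Real.log (n : ℝ)) / Real.log (n : ℝ)) ^ (1 / p) := by
  have hL := (log_log_div_log_le le_rfl le_rfl (by norm_num)).2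
  refine ⟨1000 + (32 / Real.log (Real.log 3) + 1), by positivity, ?_⟩
  intro p hp X _ _ _ hX f hf t ht
  have hp0 : 0 < p := by linarith
  have hratio : ∀ n : ℕ, t ≤ (n : ℝ) →
      0 ≤ (Real.log (Real.log (n : ℝ)) / Real.log (n : ℝ)) ^ (1 / p) := by
    intro n hn
    have h := log_log_div_log_le (ht.trans hn) le_rfl (by nlinarith)
    exact Real.rpow_nonneg (div_nonneg h.2.le (Real.log_nonneg (by linarith))) _
  -- In the zero space the lower bound `1 ≤ K` is unavailable, but the compression is at most zero.
  rcases subsingleton_or_nontrivial X with hS | hS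
  · obtain ⟨n, h1, h2⟩ := exists_nat_mem_Icc_sq ht
    refine ⟨n, h1, h2, ?_⟩
    have hω : Heisenberg.compression f (n : ℝ) ≤ 0 := by
      obtain ⟨x, y, h⟩ := Heisenberg.exists_wordDist_eq n
      refine (Heisenberg.compression_le f h).trans_eq ?_
      rw [Subsingleton.elim (f x - f y) 0, norm_zero]
    have hκ : 0 ≤ pConvexityConst X p := Real.sInf_nonneg fun K hK => hK.1.le
    have := hratio n h1
    exact (div_nonpos_of_nonpos_of_nonneg hω (by positivity)).trans (by positivity)
  obtain ⟨hκ, K, hK, hXK, hKκ⟩ := exists_pConvexIneq_le_two_mul hp0 hX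
  set κ := pConvexityConst X p
  rcases le_total t (Real.exp 16) with ht16 | ht16
  · obtain ⟨n, h1, h2, h⟩ := exists_compression_le_of_le_exp (p := p) (by linarith) hκ hf ht ht16
    refine ⟨n, h1, h2, h.trans ?_⟩
    have hκ0 : 0 ≤ κ := zero_le_one.trans hκ
    exact mul_le_mul_of_nonneg_right
      (mul_le_mul_of_nonneg_right (le_add_of_nonneg_left (by norm_num)) hκ0) (hratio n h1)
  obtain ⟨q, J, j₀, hq, hJ, hqt, hJt, hscale⟩ := exists_scales ht16
  obtain ⟨j, d, hj, hj', hd, hd', h⟩ :=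
    Heisenberg.exists_compression_le (by linarith) hK hXK hf hq hJ j₀
  obtain ⟨hs1, hs2⟩ := hscale j hj hj'
  have hd1 : (q : ℝ) ^ (2 * j + 1) ≤ d := by exact_mod_cast hd
  have hd2 : (d : ℝ) ≤ 4 * (q : ℝ) ^ (2 * j + 1) := by exact_mod_cast hd'
  have htd := hs1.trans hd1
  have htd2 := hd2.trans hs2
  refine ⟨d, htd, htd2, h.trans ?_⟩
  obtain ⟨hmono, hll⟩ := log_log_div_log_le ht htd htd2
  set x := Real.log t with hx
  have hx16 : 16 ≤ x := (Real.le_log_iff_exp_le (by linarith)).2 ht16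
  have hlx1 : 1 < Real.log x := by
    rw [Real.lt_log_iff_exp_lt (by linarith)]
    linarith [Real.exp_one_lt_d9]
  set R := Real.log (Real.log (d : ℝ)) / Real.log (d : ℝ) with hR
  have hxR : Real.log x / x ≤ 2 * R := by linarith
  have hR0 : 0 ≤ R := by
    have : 0 < Real.log x / x := by positivity
    linarith
  have hpow : ∀ {A : ℝ}, 1 ≤ A → ∀ {s : ℝ}, 0 ≤ s → s ≤ A * R → s ^ (1 / p) ≤ A * R ^ (1 / p) := by
    intro A hA s hs hsR
    calc s ^ (1 / p) ≤ (A * R) ^ (1 / p) := Real.rpow_le_rpow hs hsR (by positivity)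
      _ = A ^ (1 / p) * R ^ (1 / p) := Real.mul_rpow (by linarith) hR0
      _ ≤ A ^ (1 : ℝ) * R ^ (1 / p) := by
        gcongr
        rw [div_le_one hp0]
        linarith
      _ = _ := by rw [Real.rpow_one]
  have hJR : (1 / J : ℝ) ^ (1 / p) ≤ 16 * R ^ (1 / p) := by
    refine hpow (by norm_num) (by positivity) ?_
    have h1 : (1 / J : ℝ) ≤ 8 * (Real.log x / x) := by
      rw [div_le_iff₀ (by positivity)] at hJt
      rw [← mul_div_assoc, div_le_div_iff₀ (by exact_mod_cast hJ) (by linarith)]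
      linarith
    linarith
  -- The choice of `q` gives `(1 / x) ^ (1 / 2)`; `p ≥ 2` allows the exponent to be lowered to `1 /
  -- p`, since `1 / x ≤ 1`.
  have hqR : (1 / q : ℝ) ≤ 2 * R ^ (1 / p) := by
    have h1 : (1 / q : ℝ) ≤ (1 / x) ^ (1 / p) := by
      calc (1 / q : ℝ) ≤ 1 / Real.sqrt x :=
            one_div_le_one_div_of_le (Real.sqrt_pos.2 (by linarith)) hqt
        _ = (1 / x) ^ (1 / 2 : ℝ) := by
          rw [Real.sqrt_eq_rpow, Real.div_rpow zero_le_one (by linarith), Real.one_rpow]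
        _ ≤ (1 / x) ^ (1 / p) := by
          refine Real.rpow_le_rpow_of_exponent_ge (by positivity) ?_ ?_
          · rw [div_le_one (by linarith)]; linarith
          · exact one_div_le_one_div_of_le (by norm_num) hp
    refine h1.trans (hpow (by norm_num) (by positivity) (le_trans ?_ hxR))
    gcongr
  have hRp : 0 ≤ R ^ (1 / p) := Real.rpow_nonneg hR0 _
  calc 20 / (q : ℝ) + 16 * K * (1 / J : ℝ) ^ (1 / p)
      = 20 * (1 / q) + 16 * K * (1 / J : ℝ) ^ (1 / p) := by ring
    _ ≤ 20 * (2 * R ^ (1 / p)) + 16 * (2 * κ) * (16 * R ^ (1 / p)) := by gcongr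
    _ = (40 * 1 + 512 * κ) * R ^ (1 / p) := by ring
    -- `1 ≤ κ` lets the constant absorb the term that did not involve the target space.
    _ ≤ (40 * κ + 512 * κ) * R ^ (1 / p) := by gcongr
    _ ≤ (1000 + (32 / Real.log (Real.log 3) + 1)) * κ * R ^ (1 / p) := by
      have : 0 ≤ 32 / Real.log (Real.log 3) := by positivity
      gcongr
      nlinarith
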